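/- Let $s\ge 2$ be an integer (so $2^s\geq 4$) and let $m\geq 1$ be an odd integer. Call a vector $(v_0,v_1,\dots,v_{n-1})\in\mathbb{F}_2^n$ symmetric if $v_i=v_{n-i}$ for all $1\le i\le n-1$. Let $a=(a_0,\dots,a_{2^s-1})\in\mathbb{F}_2^{2^s}$ be a symmetric vector with $$a_0=1,\qquad a_{2^{s-1}}=0,\qquad \sum_{\substack{0\le i\le 2^{s-1}-1\\ \gcd(i,2)=1}}a_i=1,$$ and let $b=(b_0,\dots,b_{m-1})\in\mathbb{F}_2^m$ be a symmetric vector such that $\gcd\bigl(\sum_{i=0}^{m-1}b_ix^i,\;x^m-1\bigr)=1$ in $\mathbb{F}_2[x]$. Put $n=2^sm$. Then there exists a normal element $\gamma$ of $\mathbb{F}_{2^n}$ over $\mathbb{F}_2$ (that is, $\gamma,\gamma^2,\gamma^{2^2},\dots,\gamma^{2^{n-1}}$ form a basis of $\mathbb{F}_{2^n}$ over $\mathbb{F}_2$) whose corresponding vector $\bigl(\mathrm{Tr}_{\mathbb{F}_{2^n}/\mathbb{F}_2}(\gamma\cdot\gamma^{2^k})\bigr)_{0\le k\le n-1}$ is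 $(c_0,\dots,c_{n-1})$, where $$c_k=a_{k\bmod 2^s}\,b_{k\bmod m}\qquad (0\le k\le n-1).$$ -/

import Mathlib

/-- `α ∈ K` is a normal element of `K` over the finite field `F` with `q` elements: the conjugates
`α, α ^ q, …, α ^ (q ^ (n - 1))`, with `n = [K : F]`, form a basis of `K` over `F`. -/
def IsNormalElement (F : Type*) {K : Type*} [Field F] [Finite F] [Field K] [Algebra F K]
    (α : K) : Prop :=
  LinearIndependent F (fun i : Fin (Module.finrank F K) => α ^ (Nat.card F ^ (i : ℕ))) ∧
    Submodule.span F
      (Set.range fun i : Fin (Module.finrank F K) => α ^ (Nat.card F ^ (i : ℕ))) = ⊤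

/-- The corresponding vector of `α`, with entries `Tr (α * α ^ (q ^ i))` for `0 ≤ i ≤ n - 1`,
where `Tr` is the trace of `K` over the field `F` with `q` elements (and `n = [K : F]`). -/
noncomputable def correspondingVector (F : Type*) {K : Type*} [Field F] [Finite F] [Field K]
    [Algebra F K] (n : ℕ) (α : K) : Fin n → F :=
  fun i => Algebra.trace F K (α * α ^ (Nat.card F ^ (i : ℕ)))

/-- A vector `(a_0, …, a_{n-1})` is symmetric if `a_i = a_{n-i}` for `1 ≤ i ≤ n - 1`. -/
def IsSymmetricVector {R : Type*} {n : ℕ} (a : Fin n → R) : Prop :=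
  ∀ i j : Fin n, (i : ℕ) + (j : ℕ) = n → a i = a j

/-- The polynomial `a_0 + a_1 X + ⋯ + a_{n-1} X ^ (n - 1)` of a vector. -/
noncomputable def vectorPolynomial {R : Type*} [CommRing R] {n : ℕ} (a : Fin n → R) :
    Polynomial R :=
  ∑ i : Fin n, Polynomial.C (a i) * Polynomial.X ^ (i : ℕ)

/-! For `α` in an extension with Galois group `G` (here abelian), collect the traces `Tr(α · gα)`
into an element `c` of the group algebra. Let `*` be the involution inverting group elements. Then
`c* = c`, and acting on `α` by `h` turns `c` into `h h* c` (`tracePairing_groupAlgebraAct_self`). If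
`α` is normal, `c` is a unit (`isUnit_tracePairing_self`), so realising a symmetric `v` amounts to
writing `v c⁻¹` as a norm `h h*`.

In odd degree over `F_2`, every symmetric element is the square of a symmetric one, hence a norm. In
degree `2^s`, the vector of any normal element satisfies the same three conditions as `a`. Two such
symmetric vectors differ by `y² t` with `y = x + x⁻¹` and `t` symmetric
(`exists_eq_sq_mul_of_symm`). Since `y` is nilpotent, `1 + y² t` is a norm, via the equation `q² + q
= y t` (`exists_mul_eq_one_add_sq_mul`).

Finally, the degrees `2^s` and `m` are coprime, so traces of products from the two subfields factor
(`trace_mul_eq_trace_mul_trace`). Hence `γ₁ γ₂` has the vector `a_k b_k`, and normality follows by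
multiplying dual elements. -/

open AddMonoidAlgebra in
/-- The trace pairing with values in the group algebra: the coefficient at `i` is
`Tr (α * ρ i β)`. -/
noncomputable def tracePairing {F L ι : Type*} [Field F] [Field L] [Algebra F L] [AddCommGroup ι]
    [Fintype ι] (ρ : Multiplicative ι →* (L ≃ₐ[F] L)) (α β : L) : AddMonoidAlgebra F ι :=
  ∑ i, single i (Algebra.trace F L (α * ρ (.ofAdd i) β))

/-- The action of the group algebra on `L` induced by a group of automorphisms of `L`. -/
noncomputable def groupAlgebraAct {F L ι : Type*} [Field F] [Field L] [Algebra F L]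
    [AddCommGroup ι] (ρ : Multiplicative ι →* (L ≃ₐ[F] L)) (h : AddMonoidAlgebra F ι) (α : L) : L :=
  Finsupp.linearCombination F (fun i => ρ (.ofAdd i) α) h.coeff

/-- The involution of the group algebra that inverts the group elements. -/
noncomputable abbrev groupAlgebraInv (F ι : Type*) [Field F] [AddCommGroup ι] :
    AddMonoidAlgebra F ι ≃ₐ[F] AddMonoidAlgebra F ι :=
  AddMonoidAlgebra.domCongr F F (AddEquiv.neg ι)

/-! ### The trace pairing and the group algebra action. -/

section GroupAlgebra

open AddMonoidAlgebra

variable {F L ι : Type*} [Field F] [Field L] [Algebra F L] [AddCommGroup ι]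
  (ρ : Multiplicative ι →* (L ≃ₐ[F] L))

theorem groupAlgebraInv_single (i : ι) (r : F) :
    groupAlgebraInv F ι (single i r) = single (-i) r := by
  simp [groupAlgebraInv]

theorem groupAlgebraInv_coeff (h : AddMonoidAlgebra F ι) (i : ι) :
    (groupAlgebraInv F ι h).coeff i = h.coeff (-i) := by
  simp [groupAlgebraInv]

theorem groupAlgebraInv_groupAlgebraInv (h : AddMonoidAlgebra F ι) :
    groupAlgebraInv F ι (groupAlgebraInv F ι h) = h := by
  ext i
  simp

theorem groupAlgebraAct_add (g h : AddMonoidAlgebra F ι) (α : L) :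
    groupAlgebraAct ρ (g + h) α = groupAlgebraAct ρ g α + groupAlgebraAct ρ h α := by
  simp [groupAlgebraAct]

theorem groupAlgebraAct_single (i : ι) (r : F) (α : L) :
    groupAlgebraAct ρ (single i r) α = r • ρ (.ofAdd i) α := by
  simp [groupAlgebraAct]

theorem groupAlgebraAct_zero (α : L) : groupAlgebraAct ρ 0 α = 0 := by
  simp [groupAlgebraAct]

theorem trace_smul_smul (i j : ι) (α β : L) :
    Algebra.trace F L (ρ (.ofAdd j) α * ρ (.ofAdd (j + i)) β) =
      Algebra.trace F L (α * ρ (.ofAdd i) β) := by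
  rw [ofAdd_add, map_mul ρ, AlgEquiv.mul_apply, ← map_mul (ρ (.ofAdd j))]
  exact Algebra.trace_eq_of_algEquiv (ρ (.ofAdd j)) _

variable [Fintype ι]

theorem tracePairing_coeff (α β : L) (i : ι) :
    (tracePairing ρ α β).coeff i = Algebra.trace F L (α * ρ (.ofAdd i) β) := by
  classical
  simp [tracePairing, Finsupp.single_apply]

theorem tracePairing_add_left (α α' β : L) :
    tracePairing ρ (α + α') β = tracePairing ρ α β + tracePairing ρ α' β := by
  ext i
  simp [tracePairing_coeff, add_mul]

theorem groupAlgebraInv_tracePairing (α β : L) :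
    groupAlgebraInv F ι (tracePairing ρ α β) = tracePairing ρ β α := by
  ext i
  rw [groupAlgebraInv_coeff, tracePairing_coeff, tracePairing_coeff,
    ← trace_smul_smul ρ (-i) i, add_neg_cancel, ofAdd_zero, map_one, AlgEquiv.one_apply, mul_comm]

theorem tracePairing_groupAlgebraAct_left (h : AddMonoidAlgebra F ι) (α β : L) :
    tracePairing ρ (groupAlgebraAct ρ h α) β = h * tracePairing ρ α β := by
  induction h using AddMonoidAlgebra.induction_linear with
  | zero => ext i; simp [groupAlgebraAct_zero, tracePairing_coeff]
  | add f g hf hg => rw [groupAlgebraAct_add, tracePairing_add_left, hf, hg, add_mul]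
  | single j r =>
    rw [groupAlgebraAct_single, tracePairing, tracePairing, Finset.mul_sum,
      ← Equiv.sum_comp (Equiv.addLeft j)]
    refine Finset.sum_congr rfl fun i _ => ?_
    rw [single_mul_single, Equiv.coe_addLeft, smul_mul_assoc, map_smul, trace_smul_smul,
      smul_eq_mul]

theorem tracePairing_groupAlgebraAct_right (h : AddMonoidAlgebra F ι) (α β : L) :
    tracePairing ρ α (groupAlgebraAct ρ h β) = groupAlgebraInv F ι h * tracePairing ρ α β := by
  rw [← groupAlgebraInv_tracePairing, tracePairing_groupAlgebraAct_left, map_mul,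
    groupAlgebraInv_tracePairing]

theorem tracePairing_groupAlgebraAct_self (h : AddMonoidAlgebra F ι) (α : L) :
    tracePairing ρ (groupAlgebraAct ρ h α) (groupAlgebraAct ρ h α) =
      h * groupAlgebraInv F ι h * tracePairing ρ α α := by
  rw [tracePairing_groupAlgebraAct_left, tracePairing_groupAlgebraAct_right, mul_assoc]

/-- The group algebra is finite, so it suffices that the pairing is not a zero divisor. If `h` kills
it, then `hα` is trace-orthogonal to all conjugates of `α`, hence zero, and independence gives `h =
0`. -/
theorem isUnit_tracePairing_self [Finite F] [FiniteDimensional F L] [Algebra.IsSeparable F L]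
    {α : L} (hli : LinearIndependent F fun i : ι => ρ (.ofAdd i) α)
    (hspan : Submodule.span F (Set.range fun i : ι => ρ (.ofAdd i) α) = ⊤) :
    IsUnit (tracePairing ρ α α) := by
  have : Finite (ι →₀ F) := Finite.of_injective _ DFunLike.coe_injective
  have : Finite (AddMonoidAlgebra F ι) := Finite.of_equiv _ AddMonoidAlgebra.coeffEquiv.symm
  rw [isUnit_iff_mem_nonZeroDivisors_of_finite, mem_nonZeroDivisors_iff_right]
  intro h hh
  rw [← tracePairing_groupAlgebraAct_left] at hh
  have hker : ∀ x, Algebra.trace F L (groupAlgebraAct ρ h α * x) = 0 := by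
    intro x
    have hx : x ∈ Submodule.span F (Set.range fun i : ι => ρ (.ofAdd i) α) := by
      rw [hspan]; trivial
    induction hx using Submodule.span_induction with
    | mem x hx =>
      obtain ⟨i, rfl⟩ := hx
      rw [← tracePairing_coeff, hh]
      rfl
    | zero => simp
    | add x y _ _ hx hy => rw [mul_add, map_add, hx, hy, add_zero]
    | smul r x _ hx => rw [mul_smul_comm, map_smul, hx, smul_zero]
  have h0 : groupAlgebraAct ρ h α = 0 := (traceForm_nondegenerate F L).1 _ hker
  have := linearIndependent_iff.1 hli h.coeff h0
  ext i
  rw [this]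
  rfl

theorem exists_trace_eq_of_isUnit_tracePairing [DecidableEq ι] {α : L}
    (hα : IsUnit (tracePairing ρ α α)) (j : ι) :
    ∃ β : L, ∀ i, Algebra.trace F L (β * ρ (.ofAdd i) α) = if i = j then 1 else 0 := by
  obtain ⟨u, hu⟩ := hα
  refine ⟨groupAlgebraAct ρ (single j 1 * (↑u⁻¹ : AddMonoidAlgebra F ι)) α, fun i => ?_⟩
  rw [← tracePairing_coeff, tracePairing_groupAlgebraAct_left, ← hu, mul_assoc, Units.inv_mul,
    mul_one, coeff_single, Finsupp.single_apply]
  simp [eq_comm]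

end GroupAlgebra

/-! ### Norms `g · τ g` for an involution in characteristic two. -/

section Involution

variable {R : Type*} [CommRing R] [CharP R 2]

/-- The Artin–Schreier solution `z + z² + z⁴ + ⋯` telescopes and is finite because `z` is nilpotent.
-/
theorem exists_sq_add_self_eq_of_isNilpotent (τ : R →+* R) {z : R} (hz : IsNilpotent z)
    (hτz : τ z = z) : ∃ q, q ^ 2 + q = z ∧ τ q = q := by
  obtain ⟨k, hk⟩ := hz
  have key : ∀ n : ℕ, (∑ j ∈ Finset.range n, z ^ 2 ^ j) ^ 2 + ∑ j ∈ Finset.range n, z ^ 2 ^ j =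
      z ^ 2 ^ n + z := by
    intro n
    induction n with
    | zero => simp [CharTwo.add_self_eq_zero]
    | succ n ih =>
      rw [Finset.sum_range_succ, CharTwo.add_sq, add_add_add_comm, ih, ← pow_mul, ← pow_succ]
      linear_combination z ^ 2 ^ n * (CharTwo.two_eq_zero : (2 : R) = 0)
  refine ⟨∑ j ∈ Finset.range k, z ^ 2 ^ j, ?_, by simp [hτz]⟩
  rw [key, pow_eq_zero_of_le Nat.lt_two_pow_self.le hk, zero_add]

theorem exists_mul_eq_one_add_sq_mul (τ : R →+* R) (hτ : ∀ z, τ (τ z) = z) {x t : R}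
    (hx : x * τ x = 1) (hy : IsNilpotent (x + τ x)) (ht : τ t = t) :
    ∃ g, g * τ g = 1 + (x + τ x) ^ 2 * t := by
  have hτy : τ (x + τ x) = x + τ x := by rw [map_add, hτ, add_comm]
  obtain ⟨q, hq, hτq⟩ := exists_sq_add_self_eq_of_isNilpotent τ
    ((Commute.all _ _).isNilpotent_mul_right hy : IsNilpotent ((x + τ x) * t))
    (by rw [map_mul, hτy, ht])
  -- With `x τ(x) = 1` the norm is `(1 + q)² + q² + q(1 + q) y = 1 + (q² + q) y`, where `y = x + τ
  -- x`.
  refine ⟨1 + q + q * x, ?_⟩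
  have h2 : (2 : R) = 0 := CharTwo.two_eq_zero
  simp only [map_add, map_one, map_mul, hτq]
  linear_combination (x + τ x) * hq + q ^ 2 * hx + (q ^ 2 + q) * h2

/-- The Chebyshev-type recurrence with step two, using `x² + τ(x)² = (x + τ x)²`. It drives the
reduction modulo `(x + τ x)²` of even and odd powers. -/
theorem pow_add_map_pow_add_two (τ : R →+* R) {x : R} (hx : x * τ x = 1) (n : ℕ) :
    x ^ (n + 4) + τ x ^ (n + 4) =
      (x + τ x) ^ 2 * (x ^ (n + 2) + τ x ^ (n + 2)) + (x ^ n + τ x ^ n) := by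
  have h2 : (2 : R) = 0 := CharTwo.two_eq_zero
  linear_combination (-x ^ n * (x * τ x + 1 + 2 * x ^ 2) - τ x ^ n * (x * τ x + 1 + 2 * τ x ^ 2)) *
    hx - ((x ^ n + τ x ^ n) + x ^ (n + 2) + τ x ^ (n + 2)) * h2

theorem exists_pow_even_add_map_eq (τ : R →+* R) (hτ : ∀ z, τ (τ z) = z) {x : R}
    (hx : x * τ x = 1) : ∀ l : ℕ,
    ∃ t, τ t = t ∧ x ^ (2 * l) + τ x ^ (2 * l) = (x + τ x) ^ 2 * t
  | 0 => ⟨0, map_zero _, by simp [CharTwo.add_self_eq_zero]⟩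
  | 1 => ⟨1, map_one _, by simp [CharTwo.add_sq]⟩
  | l + 2 => by
    obtain ⟨t, ht, h⟩ := exists_pow_even_add_map_eq τ hτ hx l
    refine ⟨x ^ (2 * l + 2) + τ x ^ (2 * l + 2) + t, by simp [hτ, ht, add_comm], ?_⟩
    rw [mul_add 2, pow_add_map_pow_add_two τ hx, h, mul_add _ _ t]

theorem exists_pow_odd_add_map_eq (τ : R →+* R) (hτ : ∀ z, τ (τ z) = z) {x : R}
    (hx : x * τ x = 1) : ∀ l : ℕ,
    ∃ t, τ t = t ∧ x ^ (2 * l + 1) + τ x ^ (2 * l + 1) = (x + τ x) + (x + τ x) ^ 2 * t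
  | 0 => ⟨0, map_zero _, by simp⟩
  | 1 => ⟨x + τ x, by simp [hτ, add_comm], by
      have h2 : (2 : R) = 0 := CharTwo.two_eq_zero
      linear_combination (-3 * (x + τ x)) * hx - 2 * (x + τ x) * h2⟩
  | l + 2 => by
    obtain ⟨t, ht, h⟩ := exists_pow_odd_add_map_eq τ hτ hx l
    refine ⟨x ^ (2 * l + 1 + 2) + τ x ^ (2 * l + 1 + 2) + t, by simp [hτ, ht, add_comm], ?_⟩
    rw [show 2 * (l + 2) + 1 = 2 * l + 1 + 4 by ring, pow_add_map_pow_add_two τ hx, h]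
    ring

end Involution

/-! ### Symmetric elements of `F_2[Z/N]`. -/

section GroupAlgebraCharTwo

open AddMonoidAlgebra

instance {ι : Type*} [AddCommGroup ι] : CharP (AddMonoidAlgebra (ZMod 2) ι) 2 :=
  charP_of_injective_algebraMap (algebraMap (ZMod 2) _).injective 2

theorem exists_mul_groupAlgebraInv_eq_of_odd {m : ℕ} (hm : Odd m)
    {v : AddMonoidAlgebra (ZMod 2) (ZMod m)} (hv : groupAlgebraInv (ZMod 2) (ZMod m) v = v) :
    ∃ w, w * groupAlgebraInv (ZMod 2) (ZMod m) w = v := by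
  obtain ⟨k, hk⟩ := hm
  have h2 : ((k : ZMod m) + 1) + (k + 1) = 1 := by
    have : ((2 * k + 1 : ℕ) : ZMod m) = 0 := by rw [← hk, ZMod.natCast_self]
    push_cast at this
    linear_combination this
  -- Squaring doubles indices and fixes coefficients in `F_2`; as `k + 1` is the inverse of `2`
  -- modulo `m = 2k + 1`, this is the square root of `v`. It is again symmetric, so its norm is its
  -- square.
  refine ⟨mapDomain (fun i : ZMod m => (k + 1) * i) v, ?_⟩
  have hinv : ∀ u, groupAlgebraInv (ZMod 2) (ZMod m) (mapDomain (fun i => (k + 1) * i) u) =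
      mapDomain (fun i : ZMod m => (k + 1) * i) (groupAlgebraInv (ZMod 2) (ZMod m) u) := by
    intro u
    induction u using AddMonoidAlgebra.induction_linear with
    | zero => simp
    | add f g hf hg => rw [mapDomain_add, map_add, hf, hg, map_add, mapDomain_add]
    | single j r =>
      rw [groupAlgebraInv_single, mapDomain_single, mapDomain_single, groupAlgebraInv_single,
        mul_neg]
  rw [hinv, hv]
  clear hinv hv
  induction v using AddMonoidAlgebra.induction_linear with
  | zero => simp
  | add f g hf hg => rw [mapDomain_add, CharTwo.add_mul_self, hf, hg]
  | single j r =>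
    rw [mapDomain_single, single_mul_single, ← add_mul, h2, one_mul]
    congr 1
    revert r
    decide

theorem sum_zmod_eq_sum_range {M : Type*} [AddCommMonoid M] {N : ℕ} [NeZero N] (f : ZMod N → M) :
    ∑ i, f i = ∑ i ∈ Finset.range N, f i :=
  Finset.sum_nbij' ZMod.val (fun i => (i : ZMod N)) (fun i _ => Finset.mem_range.2 (ZMod.val_lt i))
    (fun _ _ => Finset.mem_univ _) (fun i _ => ZMod.natCast_zmod_val i)
    (fun i hi => ZMod.val_cast_of_lt (Finset.mem_range.1 hi)) (fun i _ => by simp)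

theorem single_one_pow_eq {N : ℕ} (i : ℕ) :
    (single (1 : ZMod N) (1 : ZMod 2) : AddMonoidAlgebra (ZMod 2) (ZMod N)) ^ i =
      single (i : ZMod N) 1 := by
  simp [single_pow]

theorem groupAlgebra_eq_sum_range {N : ℕ} [NeZero N] (d : AddMonoidAlgebra (ZMod 2) (ZMod N)) :
    d = ∑ i ∈ Finset.range N, d.coeff i •
      (single (1 : ZMod N) (1 : ZMod 2) : AddMonoidAlgebra (ZMod 2) (ZMod N)) ^ i := by
  simp_rw [single_one_pow_eq]
  rw [← sum_zmod_eq_sum_range fun i : ZMod N =>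
    d.coeff i • (single i 1 : AddMonoidAlgebra (ZMod 2) (ZMod N))]
  ext j
  simp

theorem sum_range_two_mul {M : Type*} [AddCommMonoid M] (g : ℕ → M) (r : ℕ) :
    ∑ i ∈ Finset.range (2 * r), g i = ∑ l ∈ Finset.range r, (g (2 * l) + g (2 * l + 1)) := by
  induction r with
  | zero => simp
  | succ r ih =>
    rw [mul_add_one, Finset.sum_range_succ, Finset.sum_range_succ, ih, Finset.sum_range_succ,
      add_assoc]

/-- The reflected terms run over `2r + 1, …, 4r` instead of `2r, …, 4r - 1`; the two vanishing
values absorb the mismatch. -/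
theorem sum_range_four_mul_of_eq_zero {M : Type*} [AddCommMonoid M] (h : ℕ → M) (r : ℕ)
    (h2 : h (2 * r) = 0) (h4 : h (4 * r) = 0) :
    ∑ i ∈ Finset.range (4 * r), h i = ∑ i ∈ Finset.range (2 * r), (h i + h (4 * r - i)) := by
  have key := Finset.sum_range_reflect (fun i => h (2 * r + i)) (2 * r + 1)
  rw [Finset.sum_range_succ, Finset.sum_range_succ] at key
  rw [Finset.sum_add_distrib, show 4 * r = 2 * r + 2 * r by ring, Finset.sum_range_add]
  congr 1
  rw [show 2 * r + (2 * r + 1 - 1 - 2 * r) = 2 * r by omega, show 2 * r + 2 * r = 4 * r by ring, h2,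
    h4, add_zero, add_zero] at key
  rw [← key]
  refine Finset.sum_congr rfl fun i hi => congrArg h ?_
  have := Finset.mem_range.1 hi
  omega

/-- Folding `i` with `-i` writes `d` through `x^i + x^(-i)`. Modulo `y²` times symmetric elements
this is `0` for even `i` and `y` for odd `i`, so the odd-index sum is the only obstruction. -/
theorem exists_eq_sq_mul_of_symm {r : ℕ} [NeZero (4 * r)]
    {d : AddMonoidAlgebra (ZMod 2) (ZMod (4 * r))}
    (hd : groupAlgebraInv (ZMod 2) (ZMod (4 * r)) d = d) (h0 : d.coeff 0 = 0)
    (h2 : d.coeff ((2 * r : ℕ) : ZMod (4 * r)) = 0)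
    (hodd : ∑ l ∈ Finset.range r, d.coeff ((2 * l + 1 : ℕ) : ZMod (4 * r)) = 0) :
    ∃ t, groupAlgebraInv (ZMod 2) (ZMod (4 * r)) t = t ∧
      d = (single 1 1 + groupAlgebraInv (ZMod 2) (ZMod (4 * r)) (single 1 1)) ^ 2 * t := by
  set τ := (groupAlgebraInv (ZMod 2) (ZMod (4 * r))).toRingEquiv.toRingHom with hτdef
  have hτapp : ∀ z, groupAlgebraInv (ZMod 2) (ZMod (4 * r)) z = τ z := fun _ => rfl
  have hτ : ∀ z, τ (τ z) = z := groupAlgebraInv_groupAlgebraInv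
  set x : AddMonoidAlgebra (ZMod 2) (ZMod (4 * r)) := single 1 1 with hx_def
  have hx : x * τ x = 1 := by
    rw [← hτapp, groupAlgebraInv_single, single_mul_single, add_neg_cancel, one_mul]
    rfl
  choose te hte he using exists_pow_even_add_map_eq τ hτ hx
  choose u hu ho using exists_pow_odd_add_map_eq τ hτ hx
  have hx4 : x ^ (4 * r) = 1 := by
    rw [single_one_pow_eq, ZMod.natCast_self]
    rfl
  have hsum : d = ∑ i ∈ Finset.range (2 * r),
      d.coeff (i : ZMod (4 * r)) • (x ^ i + τ x ^ i) := by
    conv_lhs => rw [groupAlgebra_eq_sum_range d]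
    rw [sum_range_four_mul_of_eq_zero _ _ (by rw [h2, zero_smul])
      (by rw [ZMod.natCast_self, h0, zero_smul])]
    refine Finset.sum_congr rfl fun i hi => ?_
    have hi' := Finset.mem_range.1 hi
    have h4 : i ≤ 4 * r := by omega
    rw [Nat.cast_sub h4, ZMod.natCast_self, zero_sub, ← groupAlgebraInv_coeff, hd, smul_add]
    congr 2
    calc x ^ (4 * r - i) = x ^ (4 * r - i) * (x * τ x) ^ i := by rw [hx, one_pow, mul_one]
      _ = τ x ^ i := by rw [mul_pow, ← mul_assoc, ← pow_add, Nat.sub_add_cancel h4, hx4, one_mul]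
  refine ⟨∑ l ∈ Finset.range r, (d.coeff ((2 * l : ℕ) : ZMod (4 * r)) • te l +
    d.coeff ((2 * l + 1 : ℕ) : ZMod (4 * r)) • u l), ?_, ?_⟩
  · simp only [map_sum, map_add, map_smul, (hτapp _).trans (hte _), (hτapp _).trans (hu _)]
  · rw [hτapp]
    calc d = _ := hsum
      _ = ∑ l ∈ Finset.range r, ((x + τ x) ^ 2 * (d.coeff ((2 * l : ℕ) : ZMod (4 * r)) • te l +
          d.coeff ((2 * l + 1 : ℕ) : ZMod (4 * r)) • u l) +
          d.coeff ((2 * l + 1 : ℕ) : ZMod (4 * r)) • (x + τ x)) := by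
        rw [sum_range_two_mul]
        refine Finset.sum_congr rfl fun l _ => ?_
        rw [he, ho, smul_add, mul_add, mul_smul_comm, mul_smul_comm]
        abel
      _ = _ := by
        rw [Finset.sum_add_distrib, ← Finset.mul_sum, ← Finset.sum_smul, hodd, zero_smul, add_zero]

end GroupAlgebraCharTwo

/-! ### Cyclic sums over odd shifts. -/

theorem sum_range_add_of_periodic {M : Type*} [AddCommGroup M] {g : ℕ → M} {p : ℕ}
    (hg : ∀ k, g (k + p) = g k) (c : ℕ) :
    ∑ k ∈ Finset.range p, g (k + c) = ∑ k ∈ Finset.range p, g k := by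
  induction c with
  | zero => rfl
  | succ c ih =>
    rw [← ih, ← add_left_inj (g c)]
    have h1 := Finset.sum_range_succ (fun k => g (k + c)) p
    have h2 := Finset.sum_range_succ' (fun k => g (k + c)) p
    simp only [zero_add, add_right_comm _ 1 c, add_comm p c, hg] at h1 h2
    rw [← h1, h2]
    rfl

/-- Every product of an even-indexed and an odd-indexed value occurs once: even `j` gives the
difference `2l + 1`, odd `j` gives its negative, and together these exhaust the odd residues modulo
`4r`. -/
theorem sum_sum_mul_odd_shift_eq {R : Type*} [CommRing R] {f : ℕ → R} {r : ℕ}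
    (hf : ∀ k, f (k + 4 * r) = f k) :
    ∑ l ∈ Finset.range r, ∑ j ∈ Finset.range (4 * r), f j * f (j + (2 * l + 1)) =
      (∑ k ∈ Finset.range (2 * r), f (2 * k)) * ∑ k ∈ Finset.range (2 * r), f (2 * k + 1) := by
  have hodd : ∀ k, ∑ l ∈ Finset.range (2 * r), f (2 * k + (2 * l + 1)) =
      ∑ l ∈ Finset.range (2 * r), f (2 * l + 1) := by
    intro k
    rw [← sum_range_add_of_periodic (g := fun l => f (2 * l + 1)) (p := 2 * r) _ k]
    · exact Finset.sum_congr rfl fun l _ => congrArg f (by ring)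
    · intro l
      rw [← hf (2 * l + 1)]
      exact congrArg f (by ring)
  have hshift : ∀ l ∈ Finset.range r,
      ∑ k ∈ Finset.range (2 * r), f (2 * k + 1) * f (2 * k + 1 + (2 * l + 1)) =
        ∑ k ∈ Finset.range (2 * r), f (2 * k) * f (2 * k + (2 * (r + (r - 1 - l)) + 1)) := by
    intro l hl
    have hl' := Finset.mem_range.1 hl
    rw [← sum_range_add_of_periodic
      (g := fun k => f (2 * k + 1) * f (2 * k + 1 + (2 * l + 1))) (p := 2 * r) _ (2 * r - l - 1)]
    · refine Finset.sum_congr rfl fun k _ => ?_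
      rw [← hf (2 * k), mul_comm]
      congr 2 <;> omega
    · intro k
      rw [← hf (2 * k + 1), ← hf (2 * k + 1 + (2 * l + 1))]
      congr 2 <;> ring
  rw [Finset.sum_mul]
  calc _ = ∑ l ∈ Finset.range r, (∑ k ∈ Finset.range (2 * r), f (2 * k) * f (2 * k + (2 * l + 1)) +
        ∑ k ∈ Finset.range (2 * r), f (2 * k) * f (2 * k + (2 * (r + (r - 1 - l)) + 1))) := by
        refine Finset.sum_congr rfl fun l hl => ?_
        rw [← hshift l hl, ← Finset.sum_add_distrib, show 4 * r = 2 * (2 * r) by ring,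
          sum_range_two_mul]
    _ = ∑ l ∈ Finset.range (2 * r), ∑ k ∈ Finset.range (2 * r),
          f (2 * k) * f (2 * k + (2 * l + 1)) := by
        rw [Finset.sum_add_distrib, Finset.sum_range_reflect (fun l =>
          ∑ k ∈ Finset.range (2 * r), f (2 * k) * f (2 * k + (2 * (r + l) + 1))) r,
          two_mul, Finset.sum_range_add]
    _ = _ := by
        rw [Finset.sum_comm]
        refine Finset.sum_congr rfl fun k _ => ?_
        rw [← Finset.mul_sum, hodd]

theorem ZMod.two_eq_one_of_ne_zero : ∀ c : ZMod 2, c ≠ 0 → c = 1 := by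
  decide

/-! ### The Galois group generated by Frobenius, and normal elements. -/

section Frobenius

variable (F L : Type*) [Field F] [Field L] [Finite L] [Algebra F L]

theorem exists_frobenius_zmod_hom [Finite F] {N : ℕ} (hN : Module.finrank F L = N) :
    ∃ ρ : Multiplicative (ZMod N) →* (L ≃ₐ[F] L), Function.Bijective ρ ∧
      ∀ (k : ℕ) (x : L), ρ (.ofAdd (k : ZMod N)) x = x ^ Nat.card F ^ k := by
  have := Fintype.ofFinite F
  have hNpos : 0 < N := hN ▸ Module.finrank_pos
  have : NeZero N := ⟨hNpos.ne'⟩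
  let σ := FiniteField.frobeniusAlgEquivOfAlgebraic F L
  have hσ : σ ^ N = 1 := by
    rw [← hN, ← FiniteField.orderOf_frobeniusAlgEquivOfAlgebraic F L, pow_orderOf_eq_one]
  let φ : ZMod N →+ Additive (L ≃ₐ[F] L) := ZMod.lift N ⟨zmultiplesHom _ (.ofMul σ), by
    simpa using congrArg Additive.ofMul hσ⟩
  let ρ : Multiplicative (ZMod N) →* (L ≃ₐ[F] L) := AddMonoidHom.toMultiplicativeLeft φ
  have hρ : ∀ k : ℕ, ρ (.ofAdd (k : ZMod N)) = σ ^ k := by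
    intro k
    have : φ (k : ZMod N) = Additive.ofMul (σ ^ k) := by
      rw [← Int.cast_natCast, ZMod.lift_coe]
      simp
    exact congrArg Additive.toMul this
  refine ⟨ρ, ?_, fun k x => ?_⟩
  · refine (Nat.bijective_iff_surjective_and_card _).2 ⟨fun g => ?_, ?_⟩
    · obtain ⟨k, rfl⟩ := (FiniteField.bijective_frobeniusAlgEquivOfAlgebraic_pow F L).2 g
      exact ⟨.ofAdd ((k : ℕ) : ZMod N), hρ k⟩
    · rw [IsGalois.card_aut_eq_finrank, hN]
      exact Nat.card_zmod N
  · rw [hρ, AlgEquiv.coe_pow, FiniteField.coe_frobeniusAlgEquivOfAlgebraic_iterate,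
      Fintype.card_eq_nat_card]

variable {F L} {ι : Type*} [AddCommGroup ι] {ρ : Multiplicative ι →* (L ≃ₐ[F] L)}

theorem exists_normal_of_bijective (hρ : Function.Bijective ρ) :
    ∃ α : L, LinearIndependent F (fun i : ι => ρ (.ofAdd i) α) ∧
      Submodule.span F (Set.range fun i : ι => ρ (.ofAdd i) α) = ⊤ := by
  let e : ι ≃ (L ≃ₐ[F] L) := Multiplicative.ofAdd.trans (Equiv.ofBijective ρ hρ)
  let b := (IsGalois.normalBasis F L).reindex e.symm
  have hb : ⇑b = fun i : ι => ρ (.ofAdd i) (IsGalois.normalBasis F L 1) := by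
    funext i
    rw [Module.Basis.reindex_apply, Equiv.symm_symm, IsGalois.normalBasis_apply]
    rfl
  exact ⟨_, hb ▸ b.linearIndependent, hb ▸ b.span_eq⟩

theorem trace_ne_zero_of_span_eq_top {α : L}
    (h : Submodule.span F (Set.range fun i : ι => ρ (.ofAdd i) α) = ⊤) :
    Algebra.trace F L α ≠ 0 := by
  intro h0
  refine Algebra.trace_ne_zero F L (LinearMap.ext_on_range h fun i => ?_)
  rw [Algebra.trace_eq_of_algEquiv (ρ (.ofAdd i)) α, h0, LinearMap.zero_apply]

end Frobenius

/-- Both the vector `w w*` of a normal element and the target `z z*` are norms, so acting by `z w⁻¹`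
carries one to the other. -/
theorem exists_tracePairing_self_eq_of_odd {L : Type*} [Field L] [Finite L] [Algebra (ZMod 2) L]
    {m : ℕ} [NeZero m] (hm : Odd m) {ρ : Multiplicative (ZMod m) →* (L ≃ₐ[ZMod 2] L)}
    (hρ : Function.Bijective ρ) {v : AddMonoidAlgebra (ZMod 2) (ZMod m)}
    (hv : groupAlgebraInv (ZMod 2) (ZMod m) v = v) : ∃ γ : L, tracePairing ρ γ γ = v := by
  obtain ⟨α, hli, hspan⟩ := exists_normal_of_bijective hρ
  obtain ⟨w, hw⟩ := exists_mul_groupAlgebraInv_eq_of_odd hm (groupAlgebraInv_tracePairing ρ α α)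
  obtain ⟨z, hz⟩ := exists_mul_groupAlgebraInv_eq_of_odd hm hv
  obtain ⟨u, rfl⟩ := isUnit_of_mul_isUnit_left (hw ▸ isUnit_tracePairing_self ρ hli hspan)
  refine ⟨groupAlgebraAct ρ (z * ↑u⁻¹) α, ?_⟩
  rw [tracePairing_groupAlgebraAct_self, ← hw, map_mul, ← hz]
  have h1 : (u : AddMonoidAlgebra (ZMod 2) (ZMod m)) * ↑u⁻¹ = 1 := u.mul_inv
  have h2 := congrArg (groupAlgebraInv (ZMod 2) (ZMod m)) h1
  rw [map_mul, map_one] at h2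
  linear_combination z * groupAlgebraInv (ZMod 2) (ZMod m) z * h1 +
    z * groupAlgebraInv (ZMod 2) (ZMod m) z * ↑u * ↑u⁻¹ * h2

/-! ### Extensions of `F_2` of degree `4r`, then of two-power degree. -/

section TwoPower

variable {L : Type*} [Field L] [Finite L] [Algebra (ZMod 2) L] {r : ℕ}

theorem algebraMap_trace_mul_pow_eq_sum (hL : Module.finrank (ZMod 2) L = 4 * r) (α : L) (i : ℕ) :
    algebraMap (ZMod 2) L (Algebra.trace (ZMod 2) L (α * α ^ 2 ^ i)) =
      ∑ j ∈ Finset.range (4 * r), α ^ 2 ^ j * α ^ 2 ^ (j + i) := by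
  rw [FiniteField.algebraMap_trace_eq_sum_pow, hL]
  refine Finset.sum_congr rfl fun j _ => ?_
  rw [Nat.card_zmod, mul_pow, ← pow_mul α, ← pow_add 2, add_comm i]

theorem pow_two_pow_add_finrank (hL : Module.finrank (ZMod 2) L = 4 * r) (α : L) (k : ℕ) :
    α ^ 2 ^ (k + 4 * r) = α ^ 2 ^ k := by
  have hcard : Nat.card L = 2 ^ (4 * r) := by
    rw [Module.natCard_eq_pow_finrank (K := ZMod 2), hL, Nat.card_zmod]
  have := Fintype.ofFinite L
  have h : α ^ 2 ^ (4 * r) = α := by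
    rw [← hcard, Nat.card_eq_fintype_card, FiniteField.pow_card]
  rw [add_comm, pow_add, pow_mul, h]

theorem trace_mul_pow_half_eq_zero (hL : Module.finrank (ZMod 2) L = 4 * r) (α : L) :
    Algebra.trace (ZMod 2) L (α * α ^ 2 ^ (2 * r)) = 0 := by
  have : CharP L 2 := charP_of_injective_algebraMap (algebraMap (ZMod 2) L).injective 2
  refine (algebraMap (ZMod 2) L).injective ?_
  rw [algebraMap_trace_mul_pow_eq_sum hL, map_zero, show 4 * r = 2 * r + 2 * r by ring,
    Finset.sum_range_add, ← Finset.sum_add_distrib]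
  refine Finset.sum_eq_zero fun j _ => ?_
  rw [show 2 * r + j + 2 * r = j + 4 * r by ring, pow_two_pow_add_finrank hL, add_comm (2 * r),
    mul_comm, CharTwo.add_self_eq_zero]

/-- Split the conjugates of `α` into even and odd Frobenius powers, with sums `E` and `O = E²`. The
quantity equals `E O = E³`, and `E + O = Tr α = 1` forces `E ≠ 0`; a nonzero element of `F_2` is
`1`. -/
theorem sum_trace_mul_pow_odd_eq_one (hL : Module.finrank (ZMod 2) L = 4 * r) {α : L}
    (hα : Algebra.trace (ZMod 2) L α = 1) :
    ∑ l ∈ Finset.range r, Algebra.trace (ZMod 2) L (α * α ^ 2 ^ (2 * l + 1)) = 1 := by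
  have : CharP L 2 := charP_of_injective_algebraMap (algebraMap (ZMod 2) L).injective 2
  have hper := pow_two_pow_add_finrank hL α
  have hprod := sum_sum_mul_odd_shift_eq (f := fun k => α ^ 2 ^ k) hper
  simp only [← algebraMap_trace_mul_pow_eq_sum hL] at hprod
  rw [← map_sum] at hprod
  set E := ∑ k ∈ Finset.range (2 * r), α ^ 2 ^ (2 * k) with hE
  set O := ∑ k ∈ Finset.range (2 * r), α ^ 2 ^ (2 * k + 1) with hO
  have hEO : E ^ 2 = O := by
    rw [hE, CharTwo.sum_sq]
    exact Finset.sum_congr rfl fun k _ => by rw [← pow_mul, ← pow_succ]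
  have hadd : E + O = 1 := by
    have h := FiniteField.algebraMap_trace_eq_sum_pow (ZMod 2) L α
    rw [hα, map_one, hL, Nat.card_zmod, show 4 * r = 2 * (2 * r) by ring, sum_range_two_mul,
      Finset.sum_add_distrib] at h
    exact h.symm
  have hne : E ≠ 0 := by
    rintro h0
    rw [h0, zero_pow two_ne_zero] at hEO
    rw [h0, ← hEO, add_zero] at hadd
    exact zero_ne_one hadd
  refine (ZMod.two_eq_one_of_ne_zero _ fun h0 => ?_)
  rw [h0, map_zero, ← hEO] at hprod
  exact mul_ne_zero hne (pow_ne_zero 2 hne) hprod.symm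

open AddMonoidAlgebra in
theorem exists_tracePairing_self_eq_of_two_pow {s : ℕ} (hs : 2 ^ s = 4 * r) [NeZero (4 * r)]
    (hL : Module.finrank (ZMod 2) L = 4 * r)
    {ρ : Multiplicative (ZMod (4 * r)) →* (L ≃ₐ[ZMod 2] L)} (hbij : Function.Bijective ρ)
    (hρ : ∀ (k : ℕ) (x : L), ρ (.ofAdd (k : ZMod (4 * r))) x = x ^ 2 ^ k)
    {v : AddMonoidAlgebra (ZMod 2) (ZMod (4 * r))}
    (hv : groupAlgebraInv (ZMod 2) (ZMod (4 * r)) v = v) (h0 : v.coeff 0 = 1)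
    (h2 : v.coeff ((2 * r : ℕ) : ZMod (4 * r)) = 0)
    (hodd : ∑ l ∈ Finset.range r, v.coeff ((2 * l + 1 : ℕ) : ZMod (4 * r)) = 1) :
    IsUnit v ∧ ∃ γ : L, tracePairing ρ γ γ = v := by
  obtain ⟨α, hli, hspan⟩ := exists_normal_of_bijective hbij
  have htr : Algebra.trace (ZMod 2) L α = 1 :=
    ZMod.two_eq_one_of_ne_zero _ (trace_ne_zero_of_span_eq_top hspan)
  have hcoeff : ∀ k : ℕ, (tracePairing ρ α α).coeff (k : ZMod (4 * r)) =
      Algebra.trace (ZMod 2) L (α * α ^ 2 ^ k) := by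
    intro k
    rw [tracePairing_coeff, hρ]
  have hc0 : (tracePairing ρ α α).coeff 0 = 1 := by
    have h := hρ 1 α
    rw [pow_one, sq] at h
    rw [tracePairing_coeff, ofAdd_zero, map_one, AlgEquiv.one_apply, ← h,
      Algebra.trace_eq_of_algEquiv, htr]
  have hunit := isUnit_tracePairing_self ρ hli hspan
  have hsymm := groupAlgebraInv_tracePairing ρ α α
  obtain ⟨t, ht, hvt⟩ := exists_eq_sq_mul_of_symm (d := tracePairing ρ α α + v)
    (by rw [map_add, hv, hsymm])
    (by rw [coeff_add, Finsupp.add_apply, hc0, h0]; rfl)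
    (by rw [coeff_add, Finsupp.add_apply, hcoeff, h2, trace_mul_pow_half_eq_zero hL]; rfl)
    (by
      simp only [coeff_add, Finsupp.add_apply, hcoeff]
      rw [Finset.sum_add_distrib, hodd, sum_trace_mul_pow_odd_eq_one hL htr]
      rfl)
  obtain ⟨u, hu⟩ := hunit
  rw [← hu] at hvt hsymm
  set c : AddMonoidAlgebra (ZMod 2) (ZMod (4 * r)) := ↑u with hc
  set c' : AddMonoidAlgebra (ZMod 2) (ZMod (4 * r)) := ↑u⁻¹ with hc'
  have hcc : c * c' = 1 := u.mul_inv
  set τ := (groupAlgebraInv (ZMod 2) (ZMod (4 * r))).toRingEquiv.toRingHom with hτdef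
  have hτapp : ∀ z, groupAlgebraInv (ZMod 2) (ZMod (4 * r)) z = τ z := fun _ => rfl
  rw [hτapp] at ht hvt hsymm
  have hsymm' : τ c' = c' := by
    have h := congrArg τ hcc
    rw [map_mul, hsymm, map_one] at h
    linear_combination c' * h - τ c' * hcc
  set x : AddMonoidAlgebra (ZMod 2) (ZMod (4 * r)) := single 1 1 with hx_def
  have hx : x * τ x = 1 := by
    rw [← hτapp, groupAlgebraInv_single, single_mul_single, add_neg_cancel, one_mul]
    rfl
  have hx4 : x ^ (4 * r) = 1 := by
    rw [single_one_pow_eq, ZMod.natCast_self]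
    rfl
  -- This is where the two-power order enters: `(x + x⁻¹)^(2^s) = 1 + 1 = 0`.
  have hy : IsNilpotent (x + τ x) := by
    refine ⟨2 ^ s, ?_⟩
    rw [add_pow_char_pow, ← map_pow, hs, hx4, map_one, CharTwo.add_self_eq_zero]
  obtain ⟨g, hg⟩ := exists_mul_eq_one_add_sq_mul τ groupAlgebraInv_groupAlgebraInv hx hy
    (show τ (c' * t) = c' * t by rw [map_mul, hsymm', ht])
  have hvg : v = g * τ g * c := by
    rw [hg]
    linear_combination hvt - (x + τ x) ^ 2 * t * hcc -
      c * (CharTwo.two_eq_zero : (2 : AddMonoidAlgebra (ZMod 2) (ZMod (4 * r))) = 0)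
  refine ⟨?_, groupAlgebraAct ρ g α, ?_⟩
  · rw [hvg, hg]
    refine IsUnit.mul (IsNilpotent.isUnit_one_add ?_) u.isUnit
    exact (Commute.all _ _).isNilpotent_mul_right (hy.pow_of_pos two_ne_zero)
  · rw [tracePairing_groupAlgebraAct_self, ← hu, hvg, hτapp]

end TwoPower

/-! ### Composing two extensions of coprime degrees. -/

section Compositum

variable {F K L₁ L₂ : Type*} [Field F] [Field K] [Field L₁] [Field L₂]
  [Algebra F K] [Algebra F L₁] [Algebra F L₂] [Finite L₁] [Finite L₂]
  {N m : ℕ} [NeZero N] [NeZero m]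
  {ρ₁ : Multiplicative (ZMod N) →* (L₁ ≃ₐ[F] L₁)} {ρ₂ : Multiplicative (ZMod m) →* (L₂ ≃ₐ[F] L₂)}

theorem algebraMap_trace_eq_sum_zmod (hN : Module.finrank F L₁ = N)
    (hρ₁ : ∀ (k : ℕ) (x : L₁), ρ₁ (.ofAdd (k : ZMod N)) x = x ^ Nat.card F ^ k)
    (j₁ : L₁ →ₐ[F] K) (u : L₁) :
    algebraMap F K (Algebra.trace F L₁ u) = ∑ i, j₁ (ρ₁ (.ofAdd i) u) := by
  rw [← j₁.commutes, FiniteField.algebraMap_trace_eq_sum_pow, hN, sum_zmod_eq_sum_range, map_sum]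
  simp only [hρ₁]

/-- Expand all traces as sums of Frobenius conjugates; the Chinese remainder theorem matches
exponents modulo `N m` with pairs of exponents. -/
theorem trace_mul_eq_trace_mul_trace [Finite K] (hNm : N.Coprime m)
    (hK : Module.finrank F K = N * m) (hN : Module.finrank F L₁ = N) (hm : Module.finrank F L₂ = m)
    (hρ₁ : ∀ (k : ℕ) (x : L₁), ρ₁ (.ofAdd (k : ZMod N)) x = x ^ Nat.card F ^ k)
    (hρ₂ : ∀ (k : ℕ) (x : L₂), ρ₂ (.ofAdd (k : ZMod m)) x = x ^ Nat.card F ^ k)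
    (j₁ : L₁ →ₐ[F] K) (j₂ : L₂ →ₐ[F] K) (u : L₁) (v : L₂) :
    Algebra.trace F K (j₁ u * j₂ v) = Algebra.trace F L₁ u * Algebra.trace F L₂ v := by
  refine (algebraMap F K).injective ?_
  have : NeZero (N * m) := ⟨mul_ne_zero (NeZero.ne N) (NeZero.ne m)⟩
  rw [map_mul (algebraMap F K), algebraMap_trace_eq_sum_zmod hN hρ₁ j₁,
    algebraMap_trace_eq_sum_zmod hm hρ₂ j₂,
    FiniteField.algebraMap_trace_eq_sum_pow, hK, Finset.sum_mul_sum, ← Fintype.sum_prod_type',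
    ← Equiv.sum_comp (ZMod.chineseRemainder hNm).toEquiv, sum_zmod_eq_sum_range]
  refine Finset.sum_congr rfl fun k _ => ?_
  have hk : (ZMod.chineseRemainder hNm).toEquiv (k : ZMod (N * m)) = ((k : ZMod N), (k : ZMod m)) :=
    map_natCast (ZMod.chineseRemainder hNm) k
  rw [hk, hρ₁, hρ₂, map_pow, map_pow, mul_pow]

theorem isNormalElement_mul [Finite F] [Finite K] (hNm : N.Coprime m)
    (hK : Module.finrank F K = N * m) (hN : Module.finrank F L₁ = N) (hm : Module.finrank F L₂ = m)
    (hρ₁ : ∀ (k : ℕ) (x : L₁), ρ₁ (.ofAdd (k : ZMod N)) x = x ^ Nat.card F ^ k)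
    (hρ₂ : ∀ (k : ℕ) (x : L₂), ρ₂ (.ofAdd (k : ZMod m)) x = x ^ Nat.card F ^ k)
    (j₁ : L₁ →ₐ[F] K) (j₂ : L₂ →ₐ[F] K) {γ₁ : L₁} {γ₂ : L₂}
    (h₁ : IsUnit (tracePairing ρ₁ γ₁ γ₁)) (h₂ : IsUnit (tracePairing ρ₂ γ₂ γ₂)) :
    IsNormalElement F (j₁ γ₁ * j₂ γ₂) := by
  have hli : LinearIndependent F fun i : Fin (Module.finrank F K) =>
      (j₁ γ₁ * j₂ γ₂) ^ (Nat.card F ^ (i : ℕ)) := by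
    rw [Fintype.linearIndependent_iff]
    intro h hsum l
    -- The product of the two dual elements at `l` pairs to `1` with the `l`-th conjugate and to `0`
    -- with the others, so it extracts the `l`-th coefficient.
    obtain ⟨u, hu⟩ := exists_trace_eq_of_isUnit_tracePairing ρ₁ h₁ ((l : ℕ) : ZMod N)
    obtain ⟨v, hv⟩ := exists_trace_eq_of_isUnit_tracePairing ρ₂ h₂ ((l : ℕ) : ZMod m)
    have htr : ∀ k : Fin (Module.finrank F K), Algebra.trace F K
        (j₁ u * j₂ v * (j₁ γ₁ * j₂ γ₂) ^ (Nat.card F ^ (k : ℕ))) = if k = l then 1 else 0 := by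
      intro k
      rw [mul_pow, mul_mul_mul_comm, ← map_pow, ← map_pow, ← hρ₁, ← hρ₂, ← map_mul, ← map_mul,
        trace_mul_eq_trace_mul_trace hNm hK hN hm hρ₁ hρ₂, hu, hv, ite_zero_mul_ite_zero, one_mul]
      refine if_congr ⟨fun hkl => Fin.ext ?_, fun hkl => by rw [hkl]; exact ⟨rfl, rfl⟩⟩ rfl rfl
      have hmod := (Nat.modEq_and_modEq_iff_modEq_mul hNm).1
        ⟨(ZMod.natCast_eq_natCast_iff _ _ _).1 hkl.1, (ZMod.natCast_eq_natCast_iff _ _ _).1 hkl.2⟩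
      exact hmod.eq_of_lt_of_lt (hK ▸ k.2) (hK ▸ l.2)
    have h0 := congrArg (fun z => Algebra.trace F K (j₁ u * j₂ v * z)) hsum
    simpa only [Finset.mul_sum, mul_smul_comm, map_sum, map_smul, htr, smul_eq_mul, mul_ite,
      mul_one, mul_zero, Finset.sum_ite_eq', Finset.mem_univ, if_true, map_zero] using h0
  have : Nonempty (Fin (Module.finrank F K)) := ⟨⟨0, Module.finrank_pos⟩⟩
  exact ⟨hli, hli.span_eq_top_of_card_eq_finrank (by simp)⟩

end Compositum

/-- The element of the group algebra of the cyclic group with the coefficients of a vector. -/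
noncomputable def vectorGroupAlgebra {R : Type*} [Semiring R] {n : ℕ} [NeZero n] (a : Fin n → R) :
    AddMonoidAlgebra R (ZMod n) :=
  .ofCoeff (Finsupp.equivFunOnFinite.symm fun i => a ⟨i.val, ZMod.val_lt i⟩)

/-! ### Vectors as group algebra elements. -/

section VectorGroupAlgebra

theorem vectorGroupAlgebra_coeff {R : Type*} [Semiring R] {n : ℕ} [NeZero n] (a : Fin n → R)
    (i : ZMod n) : (vectorGroupAlgebra a).coeff i = a ⟨i.val, ZMod.val_lt i⟩ := rfl

theorem vectorGroupAlgebra_coeff_natCast {R : Type*} [Semiring R] {n : ℕ} [NeZero n]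
    (a : Fin n → R) (k : ℕ) :
    (vectorGroupAlgebra a).coeff (k : ZMod n) = a ⟨k % n, Nat.mod_lt _ (NeZero.pos n)⟩ := by
  simp [vectorGroupAlgebra_coeff, ZMod.val_natCast]

theorem groupAlgebraInv_vectorGroupAlgebra {F : Type*} [Field F] {n : ℕ} [NeZero n] {a : Fin n → F}
    (ha : IsSymmetricVector a) :
    groupAlgebraInv F (ZMod n) (vectorGroupAlgebra a) = vectorGroupAlgebra a := by
  ext i
  rw [groupAlgebraInv_coeff, vectorGroupAlgebra_coeff, vectorGroupAlgebra_coeff]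
  by_cases hi : i = 0
  · simp [hi]
  · refine ha _ _ ?_
    simp only [ZMod.neg_val, if_neg hi]
    exact Nat.sub_add_cancel (ZMod.val_lt i).le

open AddMonoidAlgebra in
theorem isUnit_vectorGroupAlgebra {n : ℕ} [NeZero n] {b : Fin n → ZMod 2}
    (hb : IsCoprime (vectorPolynomial b) (Polynomial.X ^ n - 1)) :
    IsUnit (vectorGroupAlgebra b) := by
  set x : AddMonoidAlgebra (ZMod 2) (ZMod n) := single 1 1 with hx_def
  have hx : x ^ n = 1 := by
    rw [single_one_pow_eq, ZMod.natCast_self]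
    rfl
  have hbx : Polynomial.aeval x (vectorPolynomial b) = vectorGroupAlgebra b := by
    rw [groupAlgebra_eq_sum_range (vectorGroupAlgebra b), Finset.sum_range, vectorPolynomial,
      map_sum]
    refine Finset.sum_congr rfl fun i _ => ?_
    rw [vectorGroupAlgebra_coeff_natCast, map_mul, map_pow, Polynomial.aeval_C, Polynomial.aeval_X,
      Algebra.smul_def]
    congr 3
    exact Fin.ext (Nat.mod_eq_of_lt i.2).symm
  -- Evaluating at `x` kills `X ^ n - 1`, so coprimality becomes invertibility.
  have h := hb.map (Polynomial.aeval x).toRingHom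
  rw [AlgHom.toRingHom_eq_coe, RingHom.coe_coe, hbx] at h
  rw [map_sub, map_pow, Polynomial.aeval_X, hx, map_one, sub_self, isCoprime_zero_right] at h
  exact h

end VectorGroupAlgebra

theorem exists_tracePairing_self_eq_vectorGroupAlgebra {L : Type*} [Field L] [Finite L]
    [Algebra (ZMod 2) L] {s r N : ℕ} [NeZero N] (hs : N = 2 ^ s) (hr : N = 4 * r)
    (hL : Module.finrank (ZMod 2) L = N) {ρ : Multiplicative (ZMod N) →* (L ≃ₐ[ZMod 2] L)}
    (hbij : Function.Bijective ρ)
    (hρ : ∀ (k : ℕ) (x : L), ρ (.ofAdd (k : ZMod N)) x = x ^ 2 ^ k) {a : Fin N → ZMod 2}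
    (ha : IsSymmetricVector a) (h0 : a ⟨0, NeZero.pos N⟩ = 1)
    (h2 : a ⟨2 * r, by have := NeZero.pos N; omega⟩ = 0)
    (hodd : ∑ l : Fin r, a ⟨2 * l + 1, by omega⟩ = 1) :
    IsUnit (vectorGroupAlgebra a) ∧ ∃ γ : L, tracePairing ρ γ γ = vectorGroupAlgebra a := by
  subst hr
  refine exists_tracePairing_self_eq_of_two_pow hs.symm hL hbij hρ
    (groupAlgebraInv_vectorGroupAlgebra ha) ?_ ?_ ?_
  · simpa [vectorGroupAlgebra_coeff] using h0
  · rw [vectorGroupAlgebra_coeff_natCast, ← h2]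
    have := NeZero.pos (4 * r)
    exact congrArg a (Fin.ext (Nat.mod_eq_of_lt (by omega)))
  · rw [← hodd, Finset.sum_range]
    refine Finset.sum_congr rfl fun l _ => ?_
    rw [vectorGroupAlgebra_coeff_natCast]
    exact congrArg a (Fin.ext (Nat.mod_eq_of_lt (by omega)))

theorem sum_filter_odd_le_eq {M : Type*} [AddCommMonoid M] {N r n : ℕ} (hN : N = 4 * r)
    (hn : n = 2 * r) (a : Fin N → M) :
    ∑ i ∈ Finset.univ.filter (fun i : Fin N => (i : ℕ) ≤ n - 1 ∧ Nat.gcd (i : ℕ) 2 = 1), a i =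
      ∑ l : Fin r, a ⟨2 * l + 1, by omega⟩ := by
  symm
  refine Finset.sum_bij (fun l _ => ⟨2 * l + 1, by omega⟩) ?_ ?_ ?_ fun _ _ => rfl
  · intro l _
    simp
    omega
  · intro l _ l' _ h
    have := congrArg Fin.val h
    exact Fin.ext (by simpa using this)
  · intro i hi
    obtain ⟨h1, h2⟩ := (Finset.mem_filter.1 hi).2
    obtain ⟨l, hl⟩ := Nat.coprime_two_right.1 h2
    exact ⟨⟨l, by omega⟩, Finset.mem_univ _, Fin.ext hl.symm⟩

theorem mainTheorem6 (s m : ℕ) (hs : 4 ≤ 2 ^ s) (hm : Odd m)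
    (K : Type*) [Field K] [Algebra (ZMod 2) K] (hK : Nat.card K = 2 ^ (2 ^ s * m))
    (a : Fin (2 ^ s) → ZMod 2) (b : Fin m → ZMod 2)
    (ha_symm : IsSymmetricVector a)
    (ha_zero : a ⟨0, by omega⟩ = 1)
    (ha_half : a ⟨2 ^ s / 2, by omega⟩ = 0)
    (ha_sum : ∑ i ∈ Finset.univ.filter (fun i : Fin (2 ^ s) =>
      (i : ℕ) ≤ 2 ^ (s - 1) - 1 ∧ Nat.gcd (i : ℕ) 2 = 1), a i = 1)
    (hb_symm : IsSymmetricVector b)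
    (hb_coprime : IsCoprime (vectorPolynomial b) (Polynomial.X ^ m - 1)) :
    ∃ γ : K, IsNormalElement (ZMod 2) γ ∧
      correspondingVector (ZMod 2) (2 ^ s * m) γ = fun k : Fin (2 ^ s * m) =>
        a ⟨(k : ℕ) % 2 ^ s, Nat.mod_lt _ (Nat.two_pow_pos s)⟩ *
          b ⟨(k : ℕ) % m, Nat.mod_lt _ hm.pos⟩ := by
  have : NeZero m := ⟨hm.pos.ne'⟩
  obtain ⟨t, rfl⟩ : ∃ t, s = t + 2 := by
    refine ⟨s - 2, (Nat.sub_add_cancel ?_).symm⟩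
    exact (Nat.pow_le_pow_iff_right (a := 2) one_lt_two).1 hs
  have hr : 2 ^ (t + 2) = 4 * 2 ^ t := by ring
  have hr2 : 2 ^ (t + 2 - 1) = 2 * 2 ^ t := by
    rw [show t + 2 - 1 = t + 1 by omega]
    ring
  have hcop : (2 ^ (t + 2)).Coprime m := Nat.Coprime.pow_left _ (Nat.coprime_two_left.2 hm)
  have : Finite K := Nat.finite_of_card_ne_zero (by rw [hK]; positivity)
  have hKrank : Module.finrank (ZMod 2) K = 2 ^ (t + 2) * m := by
    rw [Module.natCard_eq_pow_finrank (K := ZMod 2), Nat.card_zmod] at hK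
    exact Nat.pow_right_injective le_rfl hK
  have hN := GaloisField.finrank 2 (n := 2 ^ (t + 2)) (by positivity)
  have hM := GaloisField.finrank 2 hm.pos.ne'
  obtain ⟨j₁⟩ := FiniteField.nonempty_algHom_of_finrank_dvd (F := ZMod 2)
    (K := GaloisField 2 (2 ^ (t + 2))) (L := K) (by rw [hN, hKrank]; exact dvd_mul_right _ _)
  obtain ⟨j₂⟩ := FiniteField.nonempty_algHom_of_finrank_dvd (F := ZMod 2)
    (K := GaloisField 2 m) (L := K) (by rw [hM, hKrank]; exact dvd_mul_left _ _)
  obtain ⟨ρ₁, hbij₁, hρ₁⟩ := exists_frobenius_zmod_hom (ZMod 2) _ hN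
  obtain ⟨ρ₂, hbij₂, hρ₂⟩ := exists_frobenius_zmod_hom (ZMod 2) _ hM
  obtain ⟨hunit, γ₁, hγ₁⟩ := exists_tracePairing_self_eq_vectorGroupAlgebra rfl hr hN hbij₁
    (fun k x => by rw [hρ₁, Nat.card_zmod]) ha_symm ha_zero
    ((congrArg a (Fin.ext (by simp only; omega))).trans ha_half)
    ((sum_filter_odd_le_eq hr hr2 a).symm.trans ha_sum)
  obtain ⟨γ₂, hγ₂⟩ := exists_tracePairing_self_eq_of_odd hm hbij₂
    (groupAlgebraInv_vectorGroupAlgebra hb_symm)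
  refine ⟨j₁ γ₁ * j₂ γ₂, isNormalElement_mul hcop hKrank hN hM hρ₁ hρ₂ j₁ j₂ (hγ₁ ▸ hunit)
    (hγ₂ ▸ isUnit_vectorGroupAlgebra hb_coprime), funext fun k => ?_⟩
  rw [correspondingVector, mul_pow, mul_mul_mul_comm, ← map_pow, ← map_pow, ← map_mul, ← map_mul,
    trace_mul_eq_trace_mul_trace hcop hKrank hN hM hρ₁ hρ₂, ← hρ₁, ← hρ₂, ← tracePairing_coeff,
    ← tracePairing_coeff, hγ₁, hγ₂, vectorGroupAlgebra_coeff_natCast,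
    vectorGroupAlgebra_coeff_natCast]
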